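/- Let $S$ be a regular local ring, let $k \ge 0$ be an integer, and let $I \subsetneq S$ be a proper ideal of height $k$ that can be generated by $k$ elements. Then the local ring $R = S/I$ is Gorenstein, in the following sense: $R$ is Cohen–Macaulay (that is, its depth equals its Krull dimension), and, writing $n = \dim S$ and $d = \dim R$, the dualizing module $\operatorname{Ext}_S^{\,n-d}(R,S)$ is a free $R$-module of rank $1$. -/

import Mathlib

open CategoryTheory IsLocalRing

universe u

/-- The depth of a local ring: the supremum of the lengths of the regular sequences that
consist of elements of the maximal ideal. -/
noncomputable def localDepth (R : Type u) [CommRing R] [IsLocalRing R] : ℕ∞ :=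
  ⨆ (rs : List R) (_ : RingTheory.Sequence.IsRegular R rs) (_ : ∀ r ∈ rs, r ∈ maximalIdeal R),
    (rs.length : ℕ∞)

/-- A Noetherian local ring is Cohen-Macaulay if its depth equals its Krull dimension. -/
class IsCohenMacaulayLocal (R : Type u) [CommRing R] : Prop extends
    IsLocalRing R, IsNoetherianRing R where
  depth_eq_dim : (localDepth R : WithBot ℕ∞) = ringKrullDim R

section DualizingModule

variable (S R : Type u) [CommRing S] [CommRing R] [Algebra S R]

/-- Multiplication by `r : R`, as an `S`-linear endomorphism of `R`. -/
def mulEnd (r : R) : ModuleCat.of S R ⟶ ModuleCat.of S R :=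
  ModuleCat.ofHom (LinearMap.mulLeft S r)

/-- The `R`-module structure of `Ext_S^i(R, S)`, by functoriality in the first variable:
`r` acts as the map that multiplication by `r` on `R` induces. -/
@[reducible]
noncomputable def extModule (i : ℕ) :
    Module R (Abelian.Ext (ModuleCat.of S R) (ModuleCat.of S S) i) where
  smul r e := (Abelian.Ext.mk₀ (mulEnd S R r)).comp e (zero_add i)
  one_smul e := by
    have h : mulEnd S R 1 = 𝟙 _ := by ext x; simp [mulEnd]
    change (Abelian.Ext.mk₀ (mulEnd S R 1)).comp e (zero_add i) = e
    rw [h]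
    exact Abelian.Ext.mk₀_id_comp e
  mul_smul r s e := by
    have h : mulEnd S R (r * s) = mulEnd S R r ≫ mulEnd S R s := by
      ext x; simpa [mulEnd] using mul_left_comm (G := R) r s x
    change (Abelian.Ext.mk₀ (mulEnd S R (r * s))).comp e (zero_add i) =
      (Abelian.Ext.mk₀ (mulEnd S R r)).comp
        ((Abelian.Ext.mk₀ (mulEnd S R s)).comp e (zero_add i)) (zero_add i)
    rw [Abelian.Ext.mk₀_comp_mk₀_assoc, h]
  smul_zero r := (Abelian.Ext.mk₀ (mulEnd S R r)).comp_zero _ _ _ (zero_add i)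
  smul_add r e f := Abelian.Ext.comp_add _ _ _ _
  add_smul r s e := by
    have h : mulEnd S R (r + s) = mulEnd S R r + mulEnd S R s := by
      ext x; simp [mulEnd, add_mul]
    change (Abelian.Ext.mk₀ (mulEnd S R (r + s))).comp e (zero_add i) =
      (Abelian.Ext.mk₀ (mulEnd S R r)).comp e (zero_add i) +
        (Abelian.Ext.mk₀ (mulEnd S R s)).comp e (zero_add i)
    rw [h, Abelian.Ext.mk₀_add, Abelian.Ext.add_comp]
  zero_smul e := by
    have h : mulEnd S R 0 = 0 := by ext x; simp [mulEnd]
    change (Abelian.Ext.mk₀ (mulEnd S R 0)).comp e (zero_add i) = 0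
    rw [h, Abelian.Ext.mk₀_zero, Abelian.Ext.zero_comp]

/-- The module `Ext_S^i(R, S)` for an `S`-algebra `R`. -/
def ExtDual (i : ℕ) : Type u :=
  Abelian.Ext (ModuleCat.of S R) (ModuleCat.of S S) i

noncomputable instance (i : ℕ) : AddCommGroup (ExtDual S R i) :=
  inferInstanceAs (AddCommGroup (Abelian.Ext (ModuleCat.of S R) (ModuleCat.of S S) i))

noncomputable instance (i : ℕ) : Module R (ExtDual S R i) :=
  extModule S R i

end DualizingModule

/-- A local ring `R` that is a homomorphic image of the regular local ring `S` is Gorenstein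
if it is Cohen-Macaulay and its dualizing module `Ext_S^(n-d)(R, S)`, where `n = dim S` and
`d = dim R`, is a free `R`-module of rank one.  Both dimensions are finite and `d ≤ n`, so the
natural number `n - d` is the true difference. -/
structure IsGorensteinImage (S R : Type u) [CommRing S] [IsRegularLocalRing S]
    [CommRing R] [Algebra S R] : Prop where
  surjective : Function.Surjective (algebraMap S R)
  cohenMacaulay : IsCohenMacaulayLocal R
  dualizing : ∃ n d : ℕ, ringKrullDim S = n ∧ ringKrullDim R = d ∧
    Module.Free R (ExtDual S R (n - d)) ∧ Module.finrank R (ExtDual S R (n - d)) = 1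

/-! The generators of `I` form an `S`-regular sequence, and everything follows from that. A regular
local ring has a regular sequence of length `n = dim S`
(`isDomain_and_hasRegularSequence_of_span_eq_maximalIdeal`), and the height of `I` gives `dim S/I ≤
n - k`. By `HasRegularSequence.isRegular_of_supportDim_le`, `k` elements that cut the dimension this
far are regular, and the quotient keeps a regular sequence of length `n - k`; so depth and dimension
of `S/I` both equal `n - k`. Dimension shifting along the generators
(`exists_extEquiv_hom_quotient`) turns `Ext^k(S/I, S)` into `Hom(S/I, S/I) = S/I`. Naturality in the
first variable makes this `S/I`-linear, because scalars act on Ext through that variable. -/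

open RingTheory.Sequence Pointwise

/-- Truncated subtraction is harmless: if `a > n`, the hypothesis forces `d = ⊥`. -/
lemma le_natCast_sub_of_add_natCast_le {d : WithBot ℕ∞} {a n : ℕ} (h : d + a ≤ n) :
    d ≤ (n - a : ℕ) := by
  induction d with
  | bot => simp
  | coe d =>
    induction d with
    | top =>
      have : (⊤ : ℕ∞) + a ≤ n := by exact_mod_cast h
      simp at this
    | coe d =>
      have : d + a ≤ n := by exact_mod_cast h
      exact WithBot.coe_le_coe.2 (Nat.cast_le.2 (by omega : d ≤ n - a))

/-! ### Regular sequences and dimension -/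

section Depth

variable {A : Type u} [CommRing A] [IsLocalRing A] [IsNoetherianRing A]

/-- `M` admits a regular sequence of length `n` inside the maximal ideal. -/
def HasRegularSequence (A : Type u) [CommRing A] [IsLocalRing A] (M : Type u) [AddCommGroup M]
    [Module A M] (n : ℕ) : Prop :=
  ∃ rs : List A, rs.length = n ∧ (∀ r ∈ rs, r ∈ maximalIdeal A) ∧ IsRegular M rs

/-- An associated prime of `M` is contained in an associated prime of `M / xM` that contains `x`,
when `x` is `M`-regular. -/
lemma exists_isAssociatedPrime_quotSMulTop {M : Type u} [AddCommGroup M] [Module A M]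
    [Module.Finite A M] {x : A} (hx : x ∈ maximalIdeal A) (hreg : IsSMulRegular M x)
    {p : Ideal A} (hp : IsAssociatedPrime p M) :
    ∃ q : Ideal A, IsAssociatedPrime q (QuotSMulTop x M) ∧ p ≤ q ∧ x ∈ q := by
  obtain ⟨hprime, m, hm⟩ := isAssociatedPrime_iff.mp hp
  let U := Submodule.torsionBySet A M (p : Set A)
  have hU (u : M) : u ∈ U ↔ ∀ a ∈ p, a • u = 0 := by
    simp [U, Submodule.mem_torsionBySet_iff]
  have hmU : m ∈ U := (hU m).2 fun a ha ↦ by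
    rw [hm, Submodule.mem_colon_singleton] at ha
    simpa using ha
  have hm0 : m ≠ 0 := by
    rintro rfl
    apply hprime.ne_top
    rw [hm]
    ext
    simp
  -- `V` is nonzero: if `U ⊆ xM`, regularity of `x` gives `U = xU`, so `U = 0` by Nakayama. As `p`
  -- and `x` both kill `V`, any associated prime of `V` serves as `q`.
  let V := U.map (x • (⊤ : Submodule A M)).mkQ
  have hV : V ≠ ⊥ := by
    intro hV
    have hle : U ≤ x • (⊤ : Submodule A M) := by
      have : U ≤ LinearMap.ker (x • (⊤ : Submodule A M)).mkQ := LinearMap.le_ker_iff_map.2 hV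
      rwa [Submodule.ker_mkQ] at this
    have hUbot : U = ⊥ := by
      refine Submodule.eq_bot_of_le_smul_of_le_jacobson_bot (Ideal.span {x}) U
        (IsNoetherian.noetherian U) ?_ ?_
      · intro u hu
        obtain ⟨w, -, rfl⟩ := Submodule.mem_smul_pointwise_iff_exists _ _ _ |>.1 (hle hu)
        refine Submodule.smul_mem_smul (Ideal.mem_span_singleton_self x) ((hU w).2 fun a ha ↦ ?_)
        refine hreg ?_
        have := (hU _).1 hu a ha
        simpa [smul_comm x a w] using this
      · rw [IsLocalRing.jacobson_eq_maximalIdeal _ bot_ne_top]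
        simpa [Ideal.span_singleton_le_iff_mem] using hx
    exact hm0 (by simpa [hUbot] using hmU)
  have : Nontrivial V := Submodule.nontrivial_iff_ne_bot.2 hV
  obtain ⟨q, hq⟩ := associatedPrimes.nonempty A V
  have hqann : Module.annihilator A V ≤ q := by
    obtain ⟨-, v, hv⟩ := isAssociatedPrime_iff.mp hq
    intro a ha
    rw [hv, Submodule.mem_colon_singleton]
    simpa using Module.mem_annihilator.1 ha v
  refine ⟨q, hq.map_of_injective V.subtype V.injective_subtype, fun a ha ↦ hqann ?_, hqann ?_⟩
  · rw [Module.mem_annihilator]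
    rintro ⟨_, u, hu, rfl⟩
    ext
    rw [Submodule.coe_smul, ← map_smul, (hU u).1 hu a ha]
    simp
  · rw [Module.mem_annihilator]
    rintro ⟨_, u, hu, rfl⟩
    ext
    rw [Submodule.coe_smul, ← map_smul]
    exact (Submodule.Quotient.mk_eq_zero _).2 (Submodule.smul_mem_pointwise_smul u x ⊤ trivial)

/-- The length of a regular sequence on `M` is at most `dim A / p` for each associated prime `p`
of `M`. -/
lemma HasRegularSequence.le_ringKrullDim_quotient {M : Type u} [AddCommGroup M] [Module A M]
    [Module.Finite A M] {n : ℕ} (h : HasRegularSequence A M n) {p : Ideal A}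
    (hp : IsAssociatedPrime p M) : (n : WithBot ℕ∞) ≤ ringKrullDim (A ⧸ p) := by
  obtain ⟨rs, rfl, hmem, hreg⟩ := h
  induction rs generalizing M p with
  | nil =>
    have := hp.isPrime
    exact ringKrullDim_nonneg_of_nontrivial
  | cons x rs ih =>
    rw [isRegular_cons_iff] at hreg
    simp only [List.mem_cons, forall_eq_or_imp] at hmem
    obtain ⟨q, hq, hpq, hxq⟩ := exists_isAssociatedPrime_quotSMulTop hmem.1 hreg.1 hp
    have hxp : x ∉ p := fun hxp ↦ by
      have : x ∈ ⋃ p ∈ associatedPrimes A M, (p : Set A) := Set.mem_biUnion hp hxp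
      rw [biUnion_associatedPrimes_eq_compl_regular] at this
      exact this hreg.1
    have := hp.isPrime
    have h1 := ringKrullDim_quotient_succ_le_of_nonZeroDivisor (R := A ⧸ p)
      (r := Ideal.Quotient.mk p x)
      (mem_nonZeroDivisors_of_ne_zero (by simpa [Ideal.Quotient.eq_zero_iff_mem] using hxp))
    let f : (A ⧸ p) ⧸ Ideal.span {Ideal.Quotient.mk p x} →+* A ⧸ q :=
      Ideal.Quotient.lift _ (Ideal.Quotient.factor hpq) fun a ha ↦ by
        obtain ⟨b, rfl⟩ := Ideal.mem_span_singleton'.1 ha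
        simp [Ideal.Quotient.eq_zero_iff_mem.2 hxq]
    have hf : Function.Surjective f :=
      Ideal.Quotient.lift_surjective_of_surjective _ _ (Ideal.Quotient.factor_surjective hpq)
    have h2 := ringKrullDim_le_of_surjective f hf
    have h3 := ih hq hmem.2 hreg.2
    push_cast [List.length_cons]
    calc (rs.length : WithBot ℕ∞) + 1 ≤ ringKrullDim (A ⧸ q) + 1 := by gcongr
      _ ≤ _ := by gcongr
      _ ≤ _ := h1

lemma supportDim_le_supportDim_quotient_ofList_add_length {M : Type u} [AddCommGroup M] [Module A M]
    [Module.Finite A M] (xs : List A) (hxs : ∀ x ∈ xs, x ∈ maximalIdeal A) :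
    Module.supportDim A M ≤
      Module.supportDim A (M ⧸ (Ideal.ofList xs • ⊤ : Submodule A M)) + xs.length := by
  induction xs generalizing M with
  | nil =>
    rw [Ideal.ofList_nil, Submodule.bot_smul]
    simpa using (Module.supportDim_eq_of_equiv (Submodule.quotEquivOfEqBot (M := M) ⊥ rfl)).ge
  | cons x xs ih =>
    simp only [List.mem_cons, forall_eq_or_imp] at hxs
    rw [Module.supportDim_eq_of_equiv (Submodule.quotOfListConsSMulTopEquivQuotSMulTopInner M x _)]
    calc _ ≤ _ := Module.supportDim_le_supportDim_quotSMulTop_succ hxs.1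
      _ ≤ _ := by grw [ih (M := QuotSMulTop x M) hxs.2]
      _ = _ := by push_cast [List.length_cons]; rw [add_assoc]

/-- Quotienting by a regular element of the maximal ideal lowers the depth by at most one. -/
lemma HasRegularSequence.quotSMulTop {M : Type u} [AddCommGroup M] [Module A M]
    [Module.Finite A M] {n : ℕ} (h : HasRegularSequence A M n) {x : A} (hx : x ∈ maximalIdeal A)
    (hreg : IsSMulRegular M x) : HasRegularSequence A (QuotSMulTop x M) (n - 1) := by
  have : Nontrivial M := h.choose_spec.2.2.nontrivial
  have := nontrivial_quotSMulTop_of_mem_maximalIdeal M hx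
  have key (N : Type u) [AddCommGroup N] [Module A N] [Module.Finite A N] [Nontrivial N] :
      maximalIdeal A • (⊤ : Submodule A N) < ⊤ :=
    (Submodule.top_ne_ideal_smul_of_le_jacobson_annihilator
      (maximalIdeal_le_jacobson _)).symm.lt_top
  -- Rees's criterion replaces regular sequences by vanishing of Ext below degree `n`; the long
  -- exact sequence of `x` costs one degree.
  have hM := ((ModuleCat.exists_isRegular_tfae (maximalIdeal A) n (ModuleCat.of A M)
    (key M)).out 3 1).1 h
  refine ((ModuleCat.exists_isRegular_tfae (maximalIdeal A) (n - 1)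
    (ModuleCat.of A (QuotSMulTop x M)) (key _)).out 1 3).1 fun i hi ↦ ?_
  have zero1 := AddCommGrpCat.isZero_of_iff_subsingleton.mpr (hM i (by omega))
  have zero2 := AddCommGrpCat.isZero_of_iff_subsingleton.mpr (hM (i + 1) (by omega))
  exact AddCommGrpCat.subsingleton_of_isZero <| ShortComplex.Exact.isZero_of_both_zeros
    ((Abelian.Ext.covariant_sequence_exact₃' _
      (IsSMulRegular.smulShortComplex_shortExact (M := ModuleCat.of A M) hreg)) i (i + 1) rfl)
    (zero1.eq_zero_of_src _) (zero2.eq_zero_of_tgt _)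

/-- If `M` has a regular sequence of length `n`, then each sequence `xs` in the maximal ideal with
`dim M / (xs)M ≤ n - xs.length` is `M`-regular, and `M / (xs)M` has a regular sequence of
length `n - xs.length`. -/
theorem HasRegularSequence.isRegular_of_supportDim_le {M : Type u} [AddCommGroup M] [Module A M]
    [Module.Finite A M] {n : ℕ} (h : HasRegularSequence A M n) (xs : List A)
    (hxs : ∀ x ∈ xs, x ∈ maximalIdeal A)
    (hdim : Module.supportDim A (M ⧸ (Ideal.ofList xs • ⊤ : Submodule A M)) + xs.length ≤ n) :
    IsRegular M xs ∧
      HasRegularSequence A (M ⧸ (Ideal.ofList xs • ⊤ : Submodule A M)) (n - xs.length) := by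
  induction xs generalizing M n with
  | nil =>
    have : Nontrivial M := h.choose_spec.2.2.nontrivial
    refine ⟨.nil A M, ?_⟩
    obtain ⟨rs, hlen, hmem, hreg⟩ := h
    refine ⟨rs, hlen, hmem, ?_⟩
    rwa [LinearEquiv.isRegular_congr (Submodule.quotEquivOfEqBot _ (by simp))]
  | cons x xs ih =>
    simp only [List.mem_cons, forall_eq_or_imp] at hxs
    have hreg : IsSMulRegular M x := by
      -- Otherwise `x` lies in an associated prime `p`. Then `dim A/p ≥ n`, while `x` is already
      -- zero on `A/p`, so `xs` alone would have to cut its dimension as far as `x :: xs` does: one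
      -- element too few.
      by_contra hx
      have : x ∈ ⋃ p ∈ associatedPrimes A M, (p : Set A) := by
        rwa [biUnion_associatedPrimes_eq_compl_regular]
      obtain ⟨p, hp, hxp⟩ := Set.mem_iUnion₂.1 this
      have h1 := h.le_ringKrullDim_quotient hp
      have h2 := supportDim_le_supportDim_quotient_ofList_add_length (M := A ⧸ p) xs hxs.2
      rw [Module.supportDim_quotient_eq_ringKrullDim] at h2
      have h3 : Module.supportDim A ((A ⧸ p) ⧸ (Ideal.ofList xs • ⊤ : Submodule A (A ⧸ p))) ≤
          Module.supportDim A (M ⧸ (Ideal.ofList (x :: xs) • ⊤ : Submodule A M)) := by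
        have hsub : Module.support A ((A ⧸ p) ⧸ (Ideal.ofList xs • ⊤ : Submodule A (A ⧸ p))) ⊆
            Module.support A (M ⧸ (Ideal.ofList (x :: xs) • ⊤ : Submodule A M)) := by
          rw [Module.support_quotient, Module.support_quotient, Module.support_eq_zeroLocus,
            Module.support_eq_zeroLocus, Ideal.annihilator_quotient]
          rintro q ⟨hq1, hq2⟩
          refine ⟨fun a ha ↦ hq1 ?_, ?_⟩
          · obtain ⟨-, m, hm⟩ := isAssociatedPrime_iff.mp hp
            rw [hm]
            simpa [Submodule.mem_colon_singleton] using Module.mem_annihilator.1 ha m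
          · rw [PrimeSpectrum.mem_zeroLocus, SetLike.coe_subset_coe, Ideal.ofList_cons, sup_le_iff]
            exact ⟨by simpa [Ideal.span_singleton_le_iff_mem] using hq1 hxp, hq2⟩
        exact Order.krullDim_le_of_strictMono (Set.inclusion hsub) fun _ _ h ↦ h
      have h4 : (n : WithBot ℕ∞) + 1 ≤ n := by
        calc (n : WithBot ℕ∞) + 1 ≤ _ := by grw [h1, h2, h3]
          _ = _ := by rw [add_assoc]; push_cast [List.length_cons]; rfl
          _ ≤ _ := hdim
      have : n + 1 ≤ n := by exact_mod_cast h4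
      omega
    have hdim' : Module.supportDim A (QuotSMulTop x M ⧸
        (Ideal.ofList xs • ⊤ : Submodule A (QuotSMulTop x M))) + xs.length ≤ (n - 1 : ℕ) := by
      rw [Module.supportDim_eq_of_equiv
        (Submodule.quotOfListConsSMulTopEquivQuotSMulTopInner M x _)] at hdim
      refine le_natCast_sub_of_add_natCast_le (a := 1) (le_of_eq_of_le ?_ hdim)
      push_cast [List.length_cons]
      rw [add_assoc]
    obtain ⟨h1, h2⟩ := ih (h.quotSMulTop hxs.1 hreg) hxs.2 hdim'
    refine ⟨.cons hreg h1, ?_⟩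
    obtain ⟨rs, hlen, hmem, hr⟩ := h2
    refine ⟨rs, by rw [hlen, List.length_cons]; omega, hmem, ?_⟩
    rwa [LinearEquiv.isRegular_congr (Submodule.quotOfListConsSMulTopEquivQuotSMulTopInner M x _)]

end Depth

/-! ### Height and dimension -/

/-- `dim A / I + height I ≤ dim A`. -/
lemma ringKrullDim_quotient_add_height_le {A : Type u} [CommRing A] (I : Ideal A) (k : ℕ)
    (hk : (k : ℕ∞) ≤ I.height) : ringKrullDim (A ⧸ I) + k ≤ ringKrullDim A := by
  rw [ringKrullDim_quotient]
  cases isEmpty_or_nonempty (PrimeSpectrum.zeroLocus (I : Set A)) with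
  | inl h => simp [Order.krullDim_eq_bot]
  | inr h =>
  rw [Order.krullDim_eq_iSup_length]
  -- A chain of primes containing `I` starts at a prime of height at least `k`, so a chain of length
  -- `k` can be put below it.
  have key (l : LTSeries (PrimeSpectrum.zeroLocus (I : Set A))) :
      ((l.length + k : ℕ) : WithBot ℕ∞) ≤ ringKrullDim A := by
    have h1 : (k : ℕ∞) ≤ Order.height l.head.1 := by
      rw [← PrimeSpectrum.height_eq_orderHeight]
      exact hk.trans (Ideal.height_mono l.head.2)
    obtain ⟨p, hp, hlen⟩ := Order.exists_series_of_le_height _ h1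
    let q := p.smash (l.map Subtype.val (fun _ _ h ↦ h)) hp
    have := Order.LTSeries.length_le_krullDim q
    rw [add_comm, ← hlen]
    exact this
  have hne : ringKrullDim A ≠ ⊥ := fun hbot ↦ by
    simpa [hbot] using key (RelSeries.singleton _ h.some)
  obtain ⟨D, hD⟩ := WithBot.ne_bot_iff_exists.1 hne
  rw [← hD] at key ⊢
  have hsup : (⨆ l : LTSeries (PrimeSpectrum.zeroLocus (I : Set A)), (l.length : ℕ∞)) + k ≤ D := by
    rw [ENat.iSup_add]
    exact iSup_le fun l ↦ by exact_mod_cast key l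
  exact_mod_cast hsup

/-! ### Ext along a regular sequence -/

section Ext

open Abelian

variable {S : Type u} [CommRing S]

lemma CategoryTheory.Abelian.Ext.comp_smul_id_eq_zero {N M : ModuleCat.{u} S} {r : S} (hr : r ∈ Module.annihilator S N)
    {n : ℕ} (e : Ext N M n) : e.comp (Ext.mk₀ (r • 𝟙 M)) (add_zero n) = 0 :=
  congrArg (fun f ↦ f.hom e) (Ext.postcomp_smul_id_eq_zero_of_mem_annihilator (M := M) hr n)

/-- If `rs` is an `M`-regular sequence of elements that annihilate `N`, then `Ext^r(N, M)`, where
`r` is the length of `rs`, is `Hom(N, M / (rs)M)`, naturally in `N`. -/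
theorem exists_extEquiv_hom_quotient [IsNoetherianRing S] (N : ModuleCat.{u} S) [Module.Finite S N] (rs : List S)
    (hann : ∀ r ∈ rs, r ∈ Module.annihilator S N) (M Q : ModuleCat.{u} S) [Module.Finite S M]
    (hreg : IsRegular M rs) (g : (M ⧸ (Ideal.ofList rs • ⊤ : Submodule S M)) ≃ₗ[S] Q) :
    ∃ φ : Ext N M rs.length ≃+ (N ⟶ Q), ∀ (f : N ⟶ N) (e : Ext N M rs.length),
      φ ((Ext.mk₀ f).comp e (zero_add _)) = f ≫ φ e := by
  induction rs generalizing M with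
  | nil =>
    let i : M ≅ Q := ((Submodule.quotEquivOfEqBot _ (by simp)).symm ≪≫ₗ g).toModuleIso
    refine ⟨Ext.addEquiv₀.trans
      { toFun := fun f ↦ f ≫ i.hom
        invFun := fun f ↦ f ≫ i.inv
        left_inv := fun f ↦ by simp
        right_inv := fun f ↦ by simp
        map_add' := fun f f' ↦ by simp }, fun f e ↦ ?_⟩
    obtain ⟨e, rfl⟩ := (Ext.mk₀_bijective _ _).2 e
    have h (h : N ⟶ M) : Ext.addEquiv₀ (Ext.mk₀ h) = h := by
      rw [← Ext.addEquiv₀_symm_apply, AddEquiv.apply_symm_apply]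
    simp only [List.length_nil, Ext.mk₀_comp_mk₀]
    simp [h]
  | cons x rs ih =>
    have hreg' := (isRegular_cons_iff _ _ _).1 hreg
    have hann' := hann
    simp only [List.mem_cons, forall_eq_or_imp] at hann
    obtain ⟨φ, hφ⟩ := ih hann.2 (ModuleCat.of S (QuotSMulTop x M)) hreg'.2
      ((Submodule.quotOfListConsSMulTopEquivQuotSMulTopInner M x rs).symm ≪≫ₗ g)
    have hS := hreg'.1.smulShortComplex_shortExact
    let δ : Ext N (ModuleCat.of S (QuotSMulTop x M)) rs.length →+ Ext N M (rs.length + 1) :=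
      hS.extClass.postcomp N rfl
    have hsub : Subsingleton (Ext N M rs.length) := by
      refine ModuleCat.subsingleton_ext_of_exists_isRegular (Ideal.ofList (x :: rs)) N ?_ M
        hreg.2.symm.lt_top (x :: rs) (fun r hr ↦ Ideal.subset_span hr) hreg rs.length (by simp)
      rw [Module.support_eq_zeroLocus]
      exact PrimeSpectrum.zeroLocus_anti_mono (Ideal.span_le.2 hann')
    -- Injective since the preceding Ext vanishes (`hsub`); surjective since `x` annihilates `N`,
    -- hence acts as zero on Ext.
    have hδ : Function.Bijective δ := by
      constructor
      · rw [injective_iff_map_eq_zero]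
        intro e he
        obtain ⟨e', rfl⟩ := Ext.covariant_sequence_exact₃ N hS e rfl he
        rw [show e' = 0 from hsub.elim (α := Ext N M rs.length) _ _, Ext.zero_comp]
        rfl
      · intro e
        exact Ext.covariant_sequence_exact₁ N hS e (Ext.comp_smul_id_eq_zero hann.1 e) rfl
    refine ⟨(AddEquiv.ofBijective δ hδ).symm.trans φ, fun f e ↦ ?_⟩
    obtain ⟨e, rfl⟩ := hδ.2 e
    have h1 : (Ext.mk₀ f).comp (δ e) (zero_add _) = δ ((Ext.mk₀ f).comp e (zero_add _)) :=
      (Ext.comp_assoc _ _ _ _ rfl (by simp)).symm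
    have h2 (e) : (AddEquiv.ofBijective δ hδ).symm (δ e) = e :=
      (AddEquiv.ofBijective δ hδ).symm_apply_apply e
    rw [AddEquiv.trans_apply, AddEquiv.trans_apply, ← hφ, h2]
    exact congrArg φ ((congrArg _ h1).trans (h2 _))

/-- If `I` is generated by a regular sequence of length `k`, then `Ext^k(S / I, S)` is free of
rank one over `S / I`. -/
theorem exists_extDual_equiv [IsNoetherianRing S] (rs : List S) (hreg : IsRegular S rs) (I : Ideal S)
    (hI : I = Ideal.ofList rs) :
    Nonempty (ExtDual S (S ⧸ I) rs.length ≃ₗ[S ⧸ I] S ⧸ I) := by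
  obtain ⟨φ, hφ⟩ := exists_extEquiv_hom_quotient (ModuleCat.of S (S ⧸ I)) rs
    (fun r hr ↦ by
      rw [Ideal.annihilator_quotient, hI]
      exact Ideal.subset_span hr)
    (ModuleCat.of S S) (ModuleCat.of S (S ⧸ I)) hreg
    (Submodule.quotEquivOfEq _ _ (by simp [hI]))
  -- `S`-linear endomorphisms of `S/I` are multiplications, because `S → S/I` is surjective.
  have hlin (f : ModuleCat.of S (S ⧸ I) ⟶ ModuleCat.of S (S ⧸ I)) (r : S ⧸ I) :
      f.hom r = r * f.hom 1 := by
    obtain ⟨s, rfl⟩ := Ideal.Quotient.mk_surjective r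
    have := f.hom.map_smul s (1 : S ⧸ I)
    rw [Algebra.smul_def, Algebra.smul_def, mul_one] at this
    exact this
  let ψ : ExtDual S (S ⧸ I) rs.length →ₗ[S ⧸ I] S ⧸ I :=
    { toFun := fun e ↦ (φ e).hom 1
      map_add' := fun e e' ↦ by
        have : φ (e + e') = φ e + φ e' := map_add φ e e'
        rw [this]
        rfl
      map_smul' := fun r e ↦ by
        have : φ (r • e) = mulEnd S (S ⧸ I) r ≫ φ e := hφ _ _
        rw [this]
        change (φ e).hom (r * 1) = r * (φ e).hom 1
        rw [mul_one, hlin] }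
  refine ⟨LinearEquiv.ofBijective ψ ⟨fun e e' h ↦ φ.injective ?_, fun r ↦ ?_⟩⟩
  · refine ModuleCat.hom_ext (LinearMap.ext fun a ↦ ?_)
    rw [hlin, hlin (φ e')]
    exact congrArg _ h
  · refine ⟨φ.symm (mulEnd S (S ⧸ I) r), ?_⟩
    change (φ (φ.symm _)).hom 1 = r
    rw [AddEquiv.apply_symm_apply]
    exact mul_one r

end Ext

/-! ### Regular local rings -/

/-- In a Noetherian local ring of dimension at least `n` whose maximal ideal has `n` generators,
there is a regular sequence of length `n`; and the ring is a domain. -/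
theorem isDomain_and_hasRegularSequence_of_span_eq_maximalIdeal (n : ℕ) (A : Type u) [CommRing A]
    [IsLocalRing A] [IsNoetherianRing A] (v : Fin n → A)
    (hv : Ideal.span (Set.range v) = maximalIdeal A) (hdim : n ≤ ringKrullDim A) :
    IsDomain A ∧ HasRegularSequence A A n := by
  induction n generalizing A with
  | zero =>
    have : maximalIdeal A = ⊥ := by rw [← hv]; simp
    exact ⟨(isField_iff_maximalIdeal_eq.2 this).isDomain, [], rfl, by simp, .nil A A⟩
  | succ n ih =>
    obtain ⟨x, hxm, hx2, hxP⟩ : ∃ x ∈ maximalIdeal A, x ∉ maximalIdeal A ^ 2 ∧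
        ∀ P ∈ minimalPrimes A, x ∉ P := by
      by_contra! hcon
      have hfin : (insert (maximalIdeal A ^ 2) (minimalPrimes A)).Finite :=
        (Ideal.finite_minimalPrimes_of_isNoetherianRing A ⊥).insert _
      have hsub : (maximalIdeal A : Set A) ⊆
          ⋃ P ∈ insert (maximalIdeal A ^ 2) (minimalPrimes A), ((id P : Ideal A) : Set A) := by
        intro x hx
        by_cases hx2 : x ∈ maximalIdeal A ^ 2
        · exact Set.mem_biUnion (Set.mem_insert _ _) hx2
        · obtain ⟨P, hP, hxP⟩ := hcon x hx hx2
          exact Set.mem_biUnion (Set.mem_insert_of_mem _ hP) hxP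
      -- Prime avoidance tolerates the one non-prime ideal `maximalIdeal A ^ 2`.
      obtain ⟨P, hP, hle⟩ := (Ideal.subset_union_prime_finite hfin (maximalIdeal A ^ 2)
        (maximalIdeal A ^ 2) (fun P hP hne _ ↦
          (Set.mem_of_mem_insert_of_ne hP hne).1.1)).1 hsub
      have hmin : maximalIdeal A ∈ minimalPrimes A := by
        rcases hP with rfl | hP
        · have hbot : maximalIdeal A = ⊥ :=
            Submodule.eq_bot_of_le_smul_of_le_jacobson_bot (maximalIdeal A) _
              (IsNoetherian.noetherian _) (by simpa [pow_two] using hle)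
              (maximalIdeal_le_jacobson _)
          refine ⟨⟨inferInstance, bot_le⟩, fun Q hQ _ ↦ by rw [hbot]; exact bot_le⟩
        · have : P.IsPrime := hP.1.1
          rwa [(maximalIdeal.isMaximal A).eq_of_le this.ne_top hle]
      have h0 : (maximalIdeal A).height = 0 := by
        exact Ideal.height_eq_zero_iff.2 hmin
      rw [← maximalIdeal_height_eq_ringKrullDim, h0] at hdim
      have : n + 1 ≤ 0 := by exact_mod_cast hdim
      omega
    obtain ⟨c, hc⟩ := Ideal.mem_span_range_iff_exists_fun.1 (hv.ge hxm)
    have hvm (i) : v i ∈ maximalIdeal A := hv.le (Ideal.subset_span ⟨i, rfl⟩)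
    -- As `x` is not in the square of the maximal ideal, some coefficient is a unit; modulo `x` the
    -- generator `v j` is then redundant.
    obtain ⟨j, hj⟩ : ∃ j, IsUnit (c j) := by
      by_contra! hcon
      refine hx2 ?_
      rw [← hc, pow_two]
      exact sum_mem fun i _ ↦ Ideal.mul_mem_mul (hcon i) (hvm i)
    let B := A ⧸ Ideal.span {x}
    have hne : Ideal.span {x} ≠ ⊤ := by
      rwa [Ne, Ideal.span_singleton_eq_top]
    have : Nontrivial B := Ideal.Quotient.nontrivial_iff.2 hne
    have : IsLocalRing B :=
      IsLocalRing.of_surjective' (Ideal.Quotient.mk _) Ideal.Quotient.mk_surjective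
    let π : A →+* B := Ideal.Quotient.mk _
    have hπ : Function.Surjective π := Ideal.Quotient.mk_surjective
    have hπx : π x = 0 := Ideal.Quotient.eq_zero_iff_mem.2 (Ideal.mem_span_singleton_self x)
    have hmax : (maximalIdeal A).map π = maximalIdeal B :=
      IsLocalRing.map_maximalIdeal_of_surjective π hπ
    have hspan : Ideal.span (Set.range fun i ↦ π (v (j.succAbove i))) = maximalIdeal B := by
      apply le_antisymm
      · rw [Ideal.span_le, ← hmax]
        rintro _ ⟨i, rfl⟩
        exact Ideal.mem_map_of_mem π (hvm _)
      · rw [← hmax, ← hv, Ideal.map_span, Ideal.span_le]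
        rintro _ ⟨_, ⟨i, rfl⟩, rfl⟩
        rcases Fin.eq_self_or_eq_succAbove j i with rfl | ⟨i, rfl⟩
        · rw [SetLike.mem_coe, ← Ideal.unit_mul_mem_iff_mem _ (hj.map π)]
          have h := congrArg π hc
          rw [hπx, Fin.sum_univ_succAbove _ i, map_add, map_mul, map_sum,
            add_eq_zero_iff_eq_neg] at h
          rw [h]
          refine neg_mem (sum_mem fun l _ ↦ ?_)
          rw [map_mul]
          exact Ideal.mul_mem_left _ _ (Ideal.subset_span ⟨l, rfl⟩)
        · exact Ideal.subset_span ⟨i, rfl⟩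
    have hdimB : (n : WithBot ℕ∞) ≤ ringKrullDim B := by
      have h := (maximalIdeal_height_eq_ringKrullDim (R := A)).ge.trans
        (Ideal.height_le_ringKrullDim_quotient_add_one hxm)
      have h' : ((n : WithBot ℕ∞)) + 1 ≤ ringKrullDim B + 1 := by
        refine le_trans ?_ h
        exact_mod_cast hdim
      revert h'
      generalize ringKrullDim B = d
      intro h'
      induction d with
      | bot => simp at h'
      | coe d =>
        have h'' : (n : ℕ∞) + 1 ≤ d + 1 := by exact_mod_cast h'
        have : (n : ℕ∞) ≤ d := (ENat.add_le_add_iff_right (by simp)).1 h''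
        exact_mod_cast this
    obtain ⟨hdom, rs, hlen, hmem, hreg⟩ := ih B _ hspan hdimB
    have hprime : (Ideal.span {x}).IsPrime := (Ideal.Quotient.isDomain_iff_prime _).1 hdom
    -- `(x)` is prime and contains a minimal prime `P`. Since `x ∉ P`, each `a * x ∈ P` has `a ∈ P`;
    -- so `P = xP`, and Nakayama gives `P = 0`.
    have hA : IsDomain A := by
      obtain ⟨P, hP, hPx⟩ := Ideal.exists_minimalPrimes_le (J := Ideal.span {x}) (I := ⊥) bot_le
      have hPprime : P.IsPrime := hP.1.1
      have hPbot : P = ⊥ := by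
        refine Submodule.eq_bot_of_le_smul_of_le_jacobson_bot (maximalIdeal A) P
          (IsNoetherian.noetherian _) (fun y hy ↦ ?_) (maximalIdeal_le_jacobson _)
        obtain ⟨a, rfl⟩ := Ideal.mem_span_singleton'.1 (hPx hy)
        rw [mul_comm]
        exact Submodule.smul_mem_smul hxm ((hPprime.mem_or_mem hy).resolve_right (hxP P hP))
      rw [hPbot] at hPprime
      exact IsDomain.of_bot_isPrime A
    refine ⟨hA, ?_⟩
    have hx0 : x ≠ 0 := by
      rintro rfl
      exact hx2 (zero_mem _)
    obtain ⟨ts, rfl⟩ := List.map_surjective_iff.2 hπ rs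
    have htm : ∀ r ∈ ts, r ∈ maximalIdeal A := fun r hr ↦ by
      have := hmem _ (List.mem_map_of_mem hr)
      rw [mem_maximalIdeal, mem_nonunits_iff] at this ⊢
      exact fun h ↦ this (h.map π)
    have hxtm : ∀ r ∈ x :: ts, r ∈ maximalIdeal A := List.forall_mem_cons.2 ⟨hxm, htm⟩
    refine ⟨x :: ts, by simpa using hlen, hxtm, ?_⟩
    refine IsRegular.of_isWeaklyRegular_of_mem_maximalIdeal A hxtm ?_
    refine .cons (fun a b h ↦ mul_left_cancel₀ hx0 h) ?_
    have h1 := (isWeaklyRegular_map_algebraMap_iff B B ts).1 hreg.1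
    refine (LinearEquiv.isWeaklyRegular_congr (Submodule.quotEquivOfEq _ _ ?_) ts).1 h1
    simp [← Submodule.ideal_span_singleton_smul]

/-- A regular local ring has a regular sequence whose length is its dimension. -/
theorem IsRegularLocalRing.exists_hasRegularSequence (S : Type u) [CommRing S]
    [IsRegularLocalRing S] : ∃ n : ℕ, ringKrullDim S = n ∧ HasRegularSequence S S n := by
  have h := IsRegularLocalRing.spanFinrank_maximalIdeal (R := S)
  refine ⟨_, h.symm, ?_⟩
  obtain ⟨s, hs, hspan⟩ := Submodule.FG.exists_span_finset_card_eq_spanFinrank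
    (IsNoetherian.noetherian (maximalIdeal S))
  refine (isDomain_and_hasRegularSequence_of_span_eq_maximalIdeal _ S
    (fun i ↦ (s.equivFinOfCardEq hs).symm i) ?_ h.le).2
  refine Eq.trans (congrArg Ideal.span ?_) hspan
  ext a
  constructor
  · rintro ⟨i, rfl⟩
    exact Subtype.prop _
  · intro ha
    exact ⟨s.equivFinOfCardEq hs ⟨a, ha⟩, by simp⟩

/-! ### The Gorenstein property -/

theorem corollary3p5 (S : Type u) [CommRing S] [IsRegularLocalRing S] (I : Ideal S) (k : ℕ)
    (hheight : I.height = k) (hgen : ∃ x : Fin k → S, I = Ideal.span (Set.range x)) :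
    IsGorensteinImage S (S ⧸ I) := by
  obtain ⟨x, hx⟩ := hgen
  -- The unit ideal has height `⊤`, so finite height makes `I` proper.
  have hItop : I ≠ ⊤ := by
    rintro rfl
    simp at hheight
  obtain ⟨n, hn, hS⟩ := IsRegularLocalRing.exists_hasRegularSequence S
  have hIx : I = Ideal.ofList (List.ofFn x) := by
    rw [hx]
    congr 1
    ext a
    simp [List.mem_ofFn]
  have hxm : ∀ a ∈ List.ofFn x, a ∈ maximalIdeal S := fun a ha ↦
    le_maximalIdeal hItop (hIx.ge (Ideal.subset_span ha))
  have hdim := ringKrullDim_quotient_add_height_le I k hheight.ge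
  rw [hn] at hdim
  let e : (S ⧸ (Ideal.ofList (List.ofFn x) • ⊤ : Submodule S S)) ≃ₗ[S] S ⧸ I :=
    Submodule.quotEquivOfEq _ _ (by simp [hIx])
  obtain ⟨hreg, rs, hlen, hmem, hrs⟩ := hS.isRegular_of_supportDim_le (List.ofFn x) hxm (by
    rw [Module.supportDim_eq_of_equiv e, Module.supportDim_quotient_eq_ringKrullDim]
    simpa using hdim)
  rw [List.length_ofFn] at hlen
  have : Nontrivial (S ⧸ I) := Ideal.Quotient.nontrivial_iff.2 hItop
  have hloc : IsLocalRing (S ⧸ I) :=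
    IsLocalRing.of_surjective' (Ideal.Quotient.mk _) Ideal.Quotient.mk_surjective
  have hmem' : ∀ r ∈ rs.map (algebraMap S (S ⧸ I)), r ∈ maximalIdeal (S ⧸ I) := by
    intro r hr
    obtain ⟨a, ha, rfl⟩ := List.mem_map.1 hr
    rw [← IsLocalRing.map_maximalIdeal_of_surjective (algebraMap S (S ⧸ I))
      Ideal.Quotient.mk_surjective]
    exact Ideal.mem_map_of_mem _ (hmem a ha)
  have hR : IsRegular (S ⧸ I) (rs.map (algebraMap S (S ⧸ I))) := by
    refine IsRegular.of_isWeaklyRegular_of_mem_maximalIdeal _ hmem' ?_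
    rw [isWeaklyRegular_map_algebraMap_iff]
    exact ((LinearEquiv.isRegular_congr e rs).1 hrs).1
  have hkn : k ≤ n := by
    have := Ideal.height_le_ringKrullDim_of_ne_top hItop
    rw [hheight, hn] at this
    exact_mod_cast this
  have hupper (ts : List (S ⧸ I)) (hts : IsRegular (S ⧸ I) ts) :
      (ts.length : WithBot ℕ∞) ≤ ringKrullDim (S ⧸ I) := by
    have : Nontrivial ((S ⧸ I) ⧸ Ideal.ofList ts) :=
      Ideal.Quotient.nontrivial_iff.2 (by simpa using hts.2.symm)
    rw [← ringKrullDim_add_length_eq_ringKrullDim_of_isRegular ts hts]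
    exact le_add_of_nonneg_left ringKrullDim_nonneg_of_nontrivial
  -- The height bounds the dimension above, the regular sequence `rs` bounds it below.
  have hdimR : ringKrullDim (S ⧸ I) = (n - k : ℕ) := by
    exact le_antisymm (le_natCast_sub_of_add_natCast_le hdim) (by simpa [hlen] using hupper _ hR)
  have hdepth : localDepth (S ⧸ I) = (n - k : ℕ) := by
    apply le_antisymm
    · refine iSup₂_le fun ts hts ↦ iSup_le fun _ ↦ ?_
      exact WithBot.coe_le_coe.1 ((hupper ts hts).trans_eq hdimR)
    · refine le_trans ?_ (le_iSup₂_of_le _ hR (le_iSup_of_le hmem' le_rfl))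
      simp [hlen]
  refine ⟨Ideal.Quotient.mk_surjective, { depth_eq_dim := ?_ }, n, n - k, hn, hdimR, ?_⟩
  · rw [hdepth, hdimR]
    rfl
  · obtain ⟨f⟩ := exists_extDual_equiv _ hreg I hIx
    rw [List.length_ofFn] at f
    rw [Nat.sub_sub_self hkn]
    exact ⟨Module.Free.of_equiv f.symm, by rw [f.finrank_eq, Module.finrank_self]⟩
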